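/- Let $\mathcal E=\{p_x,\rho_x\}_{x\in A}$ be an ensemble: $p$ is a probability distribution on a finite alphabet $A$ and the $\rho_x$ are density operators on a finite-dimensional Hilbert space $\mathcal H_B$. Put $\rho=\sum_x p_x\rho_x$, $H(p)=-\sum_x p_x\log_2 p_x$, $S(\sigma)=-\mathrm{Tr}\,\sigma\log_2\sigma$, $\bar S=\sum_x p_xS(\rho_x)$ and $\chi(\mathcal E)=S(\rho)-\bar S$. For $\mathbf x=(x_1,\dots,x_n)\in A^n$ let $p_{\mathbf x}=p_{x_1}\cdots p_{x_n}$ and $\rho_{\mathbf x}=\rho_{x_1}\otimes\cdots\otimes\rho_{x_n}$. Fix $\delta>0$. Call $\mathbf x\in A^n$ typical if $2^{-n[H(p)+\delta]}\le p_{\mathbf x}\le 2^{-n[H(p)-\delta]}$. Let $\Pi$ be the projection onto the span of the eigenvectors of $\rho^{\otimes n}$ with eigenvalue in $[2^{-n[S(\rho)+\delta]},2^{-n[S(\rho)-\delta]}]$, and $\Pi_{\mathbf x}$ the projection onto the span of the eigenvectors of $\rho_{\mathbf x}$ with eigenvalue in $[2^{-n[\bar S+\delta]},2^{-n[\bar S-\delta]}]$.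 Put $\Lambda_{\mathbf x}=\Pi\,\Pi_{\mathbf x}\,\Pi$ if $\mathbf x$ is typical and $\Lambda_{\mathbf x}=0$ otherwise. For $f:A^n\to\mathcal Y$ let $$E^f_{\mathbf y}=T^{-1/2}\Lambda_{\mathbf y}T^{-1/2},\qquad T=\sum_{\mathbf y':\,f(\mathbf y')=f(\mathbf y)}\Lambda_{\mathbf y'},$$ where $T^{-1/2}$ is the inverse square root on the support of $T$ and $0$ on its kernel. Alice announces $f(\mathbf x)$ and Bob applies the measurement $\{E^f_{\mathbf y}: f(\mathbf y)=f(\mathbf x)\}$ to $\rho_{\mathbf x}$, so the average error probability is $P_{E|f}=\sum_{\mathbf x}p_{\mathbf x}\mathrm{Tr}[\rho_{\mathbf x}(1-E^f_{\mathbf x})]$. For a random $f$ write $P_E$ for the expectation of $P_{E|f}$ over $f$. A random function $f:A^n\to\mathcal Y$ (a finite family of functions with a probability distribution on it, $\mathcal Y$ finite) is 2-universal if $\Pr[f(\mathbf x)=f(\mathbf x')]\le 1/|\mathcal Y|$ for all $\mathbf x\ne\mathbf x'$. Then: 1. For all $n$, all $f:A^n\to\mathcal Y$ and all $h\in\mathcal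 Y$, the operators $E^f_{\mathbf y}$ are positive semidefinite and $\sum_{\mathbf y:\,f(\mathbf y)=h}E^f_{\mathbf y}\le 1$. 2. For every $\varepsilon>0$ there is $N$ (depending only on $\mathcal E,\delta,\varepsilon$) such that for all $n\ge N$, all finite $\mathcal Y$ and all 2-universal random functions $f:A^n\to\mathcal Y$, $$P_E\le 8\varepsilon+\frac{4\cdot 2^{n[H(p)-\chi(\mathcal E)+3\delta]}}{|\mathcal Y|}.$$ 3. If for each $n$ a 2-universal random function $f_n:A^n\to\mathcal Y_n$ with $\log_2|\mathcal Y_n|\ge n[H(p)-\chi(\mathcal E)+4\delta]$ is used, then $P_E\to0$ as $n\to\infty$. -/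

import Mathlib

open scoped BigOperators ComplexOrder

noncomputable section

namespace HolevoHash

/-- A source ensemble `{p_x, ρ_x}`: a probability distribution on a finite alphabet `A` together
with density matrices on the finite-dimensional Hilbert space `ℂ^B`. -/
structure Ensemble (A B : Type*) [Fintype A] [Fintype B] where
  /-- the letter probabilities -/
  p : A → ℝ
  /-- the states given to Bob -/
  ρ : A → Matrix B B ℂ
  p_nonneg : ∀ a, 0 ≤ p a
  p_sum : ∑ a, p a = 1
  ρ_posSemidef : ∀ a, (ρ a).PosSemidef
  ρ_trace : ∀ a, (ρ a).trace = 1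

/-- Von Neumann entropy (in bits) `-Tr (M log₂ M)`, with `0 log₂ 0 = 0`. -/
def vonNeumannEntropy {C : Type*} [Fintype C] [DecidableEq C] (M : Matrix C C ℂ) : ℝ :=
  -((cfc (fun t : ℝ => t * Real.logb 2 t) M).trace).re

/-- The projection onto the span of the eigenvectors of the Hermitian matrix `M` whose
eigenvalues lie in `[a, b]`. -/
def spectralProj {C : Type*} [Fintype C] [DecidableEq C] (M : Matrix C C ℂ) (a b : ℝ) :
    Matrix C C ℂ :=
  cfc (Set.indicator (Set.Icc a b) (fun _ : ℝ => (1 : ℝ))) M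

/-- The inverse square root of a positive semidefinite matrix on its support (and `0` on its
kernel, since `(√0)⁻¹ = 0`). -/
def invSqrt {C : Type*} [Fintype C] [DecidableEq C] (M : Matrix C C ℂ) : Matrix C C ℂ :=
  cfc (fun t : ℝ => (Real.sqrt t)⁻¹) M

/-- The tensor product `M_1 ⊗ ⋯ ⊗ M_n` as a matrix indexed by length-`n` words. -/
def tensor {B : Type*} {n : ℕ} (M : Fin n → Matrix B B ℂ) :
    Matrix (Fin n → B) (Fin n → B) ℂ :=
  Matrix.of fun b b' => ∏ i, M i (b i) (b' i)

namespace Ensemble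

variable {A B : Type*} [Fintype A] [Fintype B] [DecidableEq B]

/-- Shannon entropy `H(p)` in bits. -/
def H (E : Ensemble A B) : ℝ := -∑ a, E.p a * Real.logb 2 (E.p a)

/-- The average state `ρ = ∑ p_x ρ_x`. -/
def avg (E : Ensemble A B) : Matrix B B ℂ := ∑ a, (E.p a : ℂ) • E.ρ a

/-- The average entropy `∑ p_x S(ρ_x)`. -/
def condEntropy (E : Ensemble A B) : ℝ := ∑ a, E.p a * vonNeumannEntropy (E.ρ a)

/-- The Holevo quantity `χ = S(ρ) - ∑ p_x S(ρ_x)`. -/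
def χ (E : Ensemble A B) : ℝ := vonNeumannEntropy E.avg - E.condEntropy

/-- The probability `p_{x_1} ⋯ p_{x_n}` of a block. -/
def blockProb (E : Ensemble A B) {n : ℕ} (x : Fin n → A) : ℝ := ∏ i, E.p (x i)

/-- The state `ρ_{x_1} ⊗ ⋯ ⊗ ρ_{x_n}` of a block. -/
def blockState (E : Ensemble A B) {n : ℕ} (x : Fin n → A) :
    Matrix (Fin n → B) (Fin n → B) ℂ :=
  tensor fun i => E.ρ (x i)

/-- A block is `δ`-typical if its probability is within a factor `2^{± n δ}` of its likely value
`2^{-n H(p)}`. -/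
def IsTypical (E : Ensemble A B) (δ : ℝ) {n : ℕ} (x : Fin n → A) : Prop :=
  E.blockProb x ∈ Set.Icc ((2 : ℝ) ^ (-(n : ℝ) * (E.H + δ))) ((2 : ℝ) ^ (-(n : ℝ) * (E.H - δ)))

/-- The projection `Π` onto the `δ`-typical subspace of `ρ^{⊗ n}`: eigenvalues within a factor
`2^{± n δ}` of the likely value `2^{-n S(ρ)}`. -/
def typProj (E : Ensemble A B) (δ : ℝ) (n : ℕ) : Matrix (Fin n → B) (Fin n → B) ℂ :=
  spectralProj (tensor fun _ : Fin n => E.avg)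
    ((2 : ℝ) ^ (-(n : ℝ) * (vonNeumannEntropy E.avg + δ)))
    ((2 : ℝ) ^ (-(n : ℝ) * (vonNeumannEntropy E.avg - δ)))

/-- The projection `Π_x` onto the `δ`-typical subspace of `ρ_x`: eigenvalues within a factor
`2^{± n δ}` of the likely value `2^{-n ∑ p_j S(ρ_j)}`. -/
def condTypProj (E : Ensemble A B) (δ : ℝ) {n : ℕ} (x : Fin n → A) :
    Matrix (Fin n → B) (Fin n → B) ℂ :=
  spectralProj (E.blockState x)
    ((2 : ℝ) ^ (-(n : ℝ) * (E.condEntropy + δ)))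
    ((2 : ℝ) ^ (-(n : ℝ) * (E.condEntropy - δ)))

open Classical in
/-- `Λ_x = Π Π_x Π` for typical `x`, and `0` for nontypical `x`. -/
def Λ (E : Ensemble A B) (δ : ℝ) {n : ℕ} (x : Fin n → A) :
    Matrix (Fin n → B) (Fin n → B) ℂ :=
  if E.IsTypical δ x then E.typProj δ n * E.condTypProj δ x * E.typProj δ n else 0

/-- `T = ∑ Λ_y` over all blocks `y` with hash value `f y = h`. -/
def T (E : Ensemble A B) (δ : ℝ) {n : ℕ} {Y : Type*} [DecidableEq Y]
    (f : (Fin n → A) → Y) (h : Y) : Matrix (Fin n → B) (Fin n → B) ℂ :=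
  ∑ y with f y = h, E.Λ δ y

/-- The element `E_y^f = T^{-1/2} Λ_y T^{-1/2}` of Bob's pretty good measurement, used when the
announced hash value is `f y`. -/
def povm (E : Ensemble A B) (δ : ℝ) {n : ℕ} {Y : Type*} [DecidableEq Y]
    (f : (Fin n → A) → Y) (y : Fin n → A) : Matrix (Fin n → B) (Fin n → B) ℂ :=
  invSqrt (E.T δ f (f y)) * E.Λ δ y * invSqrt (E.T δ f (f y))

/-- The error probability `∑ p_x Tr[ρ_x (1 - E_x^f)]` for a given hash function `f`. -/
def errorGiven (E : Ensemble A B) (δ : ℝ) {n : ℕ} {Y : Type*} [DecidableEq Y]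
    (f : (Fin n → A) → Y) : ℝ :=
  ∑ x, E.blockProb x * ((E.blockState x * (1 - E.povm δ f x)).trace).re

end Ensemble

/-- A random function `X → Y`: a finite family of functions indexed by seeds `k : K`, with a
probability distribution on the seeds. -/
structure RandomHash (X Y K : Type*) [Fintype K] where
  /-- the functions of the family -/
  f : K → X → Y
  /-- the probability of each seed -/
  q : K → ℝ
  q_nonneg : ∀ k, 0 ≤ q k
  q_sum : ∑ k, q k = 1

/-- 2-universality: `Pr[f(x) = f(x')] ≤ 1 / |Y|` for all `x ≠ x'`. -/
def RandomHash.IsTwoUniversal {X Y K : Type*} [Fintype K] [Fintype Y] [DecidableEq Y]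
    (F : RandomHash X Y K) : Prop :=
  ∀ x x' : X, x ≠ x' → ∑ k with F.f k x = F.f k x', F.q k ≤ 1 / (Fintype.card Y : ℝ)

/-- The error probability averaged over the random hash function. -/
def avgError {A B : Type*} [Fintype A] [Fintype B] [DecidableEq B] (E : Ensemble A B) (δ : ℝ)
    {n : ℕ} {Y K : Type*} [Fintype K] [DecidableEq Y] (F : RandomHash (Fin n → A) Y K) : ℝ :=
  ∑ k, F.q k * E.errorGiven δ (F.f k)

end HolevoHash

end

namespace HolevoHash

open scoped MatrixOrder

/-! ### Operator inequalities and functional calculus for matrices. -/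

section Matrix

/-! The POVM property holds because the operators with hash value `h` sum to `T^{-1/2} T T^{-1/2} ≤
1`.

For the error, the Hayashi–Nagaoka inequality `one_sub_invSqrt_conj_le` replaces the pretty good
measurement by two traces: `2 Tr ρ_x (1 - Λ_x)`, and `4 Tr ρ_x Λ_y` summed over the `y ≠ x` that
collide with `x`.

The first trace does not involve the hash. Its mean is at most the atypical mass of the source plus
3 and 2 times the failure probabilities of `Π` and `Π_x`. Diagonalizing the states makes all three
classical i.i.d. quantities, and Chebyshev (`tendsto_atypicalMass`) sends them to 0.

In the second trace the hash enters only through the collision indicator, so 2-universality costs a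
factor `1/|Y|`. Averaging over `x` then turns `ρ_x` into `ρ^{⊗n}`, and `Tr ρ^{⊗n} Λ_y ≤ p_y
2^{n(H-χ+3δ)}` (`re_trace_tensor_avg_mul_Λ_le`) sums over `y` to the stated exponential. -/

theorem conj_nonneg_of_isSelfAdjoint {C : Type*} [Fintype C] {R M : Matrix C C ℂ}
    (hR : IsSelfAdjoint R) (hM : 0 ≤ M) :
    0 ≤ R * M * R := by
  simpa only [hR.star_eq] using star_left_conjugate_nonneg hM R

variable {C : Type*} [Fintype C] [DecidableEq C]

theorem re_trace_mul_nonneg {M N : Matrix C C ℂ} (hM : 0 ≤ M) (hN : 0 ≤ N) :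
    0 ≤ ((M * N).trace).re := by
  obtain ⟨X, rfl⟩ := CStarAlgebra.nonneg_iff_eq_star_mul_self.mp hM
  have h := (Matrix.nonneg_iff_posSemidef.mp hN).mul_mul_conjTranspose_same X
  rw [mul_assoc, Matrix.trace_mul_comm]
  exact (Complex.le_def.mp h.trace_nonneg).1

theorem re_trace_mul_le_re_trace_mul {R M N : Matrix C C ℂ} (hR : 0 ≤ R) (h : M ≤ N) :
    ((R * M).trace).re ≤ ((R * N).trace).re := by
  have := re_trace_mul_nonneg hR (sub_nonneg.mpr h)
  rw [mul_sub, Matrix.trace_sub, Complex.sub_re] at this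
  linarith

theorem continuousOn_spectrum (f : ℝ → ℝ) (M : Matrix C C ℂ) :
    ContinuousOn f (spectrum ℝ M) :=
  (Matrix.finite_real_spectrum (A := M)).continuousOn f

section OperatorMonotone

open scoped Matrix.Norms.L2Operator

/-- The square root is operator monotone; squaring is not, so there is no converse. -/
theorem le_of_sq_le_sq {M N : Matrix C C ℂ} (hM : 0 ≤ M) (hN : 0 ≤ N) (h : M ^ 2 ≤ N ^ 2) :
    M ≤ N := by
  have := CFC.monotone_sqrt h
  rwa [CFC.sqrt_sq M hM, CFC.sqrt_sq N hN] at this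

end OperatorMonotone

/-- The map `d ↦ U diag(d) U*` is a real algebra homomorphism, hence commutes with polynomials. A
Lagrange interpolant of `f` whose nodes include both the spectrum and the values of `d` reduces any
`f`, even a discontinuous one, to that case. -/
theorem cfc_unitary_conj_diagonal {U : Matrix C C ℂ} (hU : star U * U = 1) (d : C → ℝ)
    (f : ℝ → ℝ) :
    cfc f (U * Matrix.diagonal (fun c => (d c : ℂ)) * star U)
      = U * Matrix.diagonal (fun c => (f (d c) : ℂ)) * star U := by
  have hU' : U * star U = 1 := mul_eq_one_comm.mp hU
  let D : (C → ℝ) →ₐ[ℝ] Matrix C C ℂ :=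
    { toFun := fun d => U * Matrix.diagonal (fun c => (d c : ℂ)) * star U
      map_one' := by simp [hU']
      map_mul' := fun x y => by
        have h : U * Matrix.diagonal (fun c => (x c : ℂ)) * star U *
            (U * Matrix.diagonal (fun c => (y c : ℂ)) * star U) =
            U * Matrix.diagonal (fun c => (x c : ℂ)) * (star U * U) *
            Matrix.diagonal (fun c => (y c : ℂ)) * star U := by noncomm_ring
        rw [h, hU, mul_one, mul_assoc U (Matrix.diagonal _) (Matrix.diagonal _),
          Matrix.diagonal_mul_diagonal]
        simp
      map_zero' := by simp
      map_add' := fun x y => by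
        rw [← add_mul, ← mul_add, Matrix.diagonal_add]
        simp
      commutes' := fun r => by
        have h : Matrix.diagonal (fun c => ((algebraMap ℝ (C → ℝ) r c : ℝ) : ℂ))
            = (r : ℂ) • (1 : Matrix C C ℂ) := by
          rw [← Matrix.diagonal_one, ← Matrix.diagonal_smul]; simp [Pi.smul_def]
        rw [h, mul_smul_comm, mul_one, smul_mul_assoc, hU', Algebra.algebraMap_eq_smul_one]
        simp }
  have hself : IsSelfAdjoint (D d) := by
    change star (U * Matrix.diagonal (fun c => (d c : ℂ)) * star U) = _
    simp [mul_assoc, Matrix.star_eq_conjTranspose, Matrix.diagonal_conjTranspose, Pi.star_def, D]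
  set s : Finset ℝ := (Matrix.finite_real_spectrum (A := D d)).toFinset ∪ Finset.univ.image d
  set q : Polynomial ℝ := Lagrange.interpolate s id f
  have hq : ∀ t ∈ s, q.eval t = f t := fun t ht =>
    Lagrange.eval_interpolate_at_node (v := id) f Function.injective_id.injOn ht
  have h1 : cfc f (D d) = cfc q.eval (D d) :=
    cfc_congr fun t ht => (hq t (Finset.mem_union_left _ (by simpa using ht))).symm
  have h2 : Polynomial.aeval d q = fun c => f (d c) := by
    funext c
    rw [← hq (d c) (Finset.mem_union_right _ (by simp))]
    simp [Polynomial.aeval_def]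
  change cfc f (D d) = D (fun c => f (d c))
  rw [h1, cfc_polynomial q (D d) hself, Polynomial.aeval_algHom_apply, h2]

/-- If `P` is an orthogonal projection and `0 ≤ Q ≤ 1`, then `P Q P` is close to `1` as soon as
both `P` and `Q` are. -/
theorem one_sub_conj_le {P Q : Matrix C C ℂ} (hP : IsStarProjection P) (hQ : 0 ≤ Q)
    (hQ1 : Q ≤ 1) :
    1 - P * Q * P ≤ 3 • (1 - P) + 2 • (1 - Q) := by
  have hsa : IsSelfAdjoint (1 - P) := (IsSelfAdjoint.one _).sub hP.2
  have h1 := conj_nonneg_of_isSelfAdjoint ((IsSelfAdjoint.one _).add hsa) (sub_nonneg.mpr hQ1)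
  have h2 := conj_nonneg_of_isSelfAdjoint hsa hQ
  have hPP : P * P = P := hP.1
  rw [← sub_nonneg]
  -- The two sides differ by `P - P²`; both summands on the right are conjugates of positive
  -- operators.
  have key : 3 • (1 - P) + 2 • (1 - Q) - (1 - P * Q * P) =
      (1 + (1 - P)) * (1 - Q) * (1 + (1 - P)) + 2 • ((1 - P) * Q * (1 - P)) := by
    have h : 3 • (1 - P) + 2 • (1 - Q) - (1 - P * Q * P) -
      ((1 + (1 - P)) * (1 - Q) * (1 + (1 - P)) + 2 • ((1 - P) * Q * (1 - P))) = P - P * P := by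
        noncomm_ring
    rw [← sub_eq_zero, h, hPP, sub_self]
  rw [key]
  exact add_nonneg h1 (nsmul_nonneg h2 2)

theorem spectrum_nonneg {M : Matrix C C ℂ} (hM : 0 ≤ M) {t : ℝ} (ht : t ∈ spectrum ℝ M) :
    0 ≤ t :=
  spectrum_nonneg_of_nonneg hM ht

theorem isSelfAdjoint_invSqrt (M : Matrix C C ℂ) : IsSelfAdjoint (invSqrt M) :=
  cfc_predicate _ M

theorem invSqrt_mul_self_mul_invSqrt_le_one {M : Matrix C C ℂ} (hM : 0 ≤ M) :
    invSqrt M * M * invSqrt M ≤ 1 := by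
  have hsa : IsSelfAdjoint M := .of_nonneg hM
  have h : invSqrt M * M * invSqrt M =
      cfc (fun t : ℝ => (Real.sqrt t)⁻¹ * t * (Real.sqrt t)⁻¹) M := by
    rw [cfc_mul (fun t : ℝ => (Real.sqrt t)⁻¹ * t) _ M (continuousOn_spectrum _ _)
      (continuousOn_spectrum _ _), cfc_mul _ (fun t : ℝ => t) M (continuousOn_spectrum _ _)
      (continuousOn_spectrum _ _), cfc_id' ℝ M, invSqrt]
  rw [h]
  refine cfc_le_one _ _ fun t ht => ?_
  have ht0 := spectrum_nonneg hM ht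
  rw [mul_right_comm, ← mul_inv, Real.mul_self_sqrt ht0]
  exact inv_mul_le_one

/-- The **Hayashi–Nagaoka inequality** for the pretty good measurement. -/
theorem one_sub_invSqrt_conj_le {S T : Matrix C C ℂ} (hS : 0 ≤ S) (hS1 : S ≤ 1) (hT : 0 ≤ T) :
    1 - invSqrt (S + T) * S * invSqrt (S + T) ≤ 2 • (1 - S) + 4 • T := by
  set W := S + T with hW
  have hW0 : 0 ≤ W := add_nonneg hS hT
  have hsa : IsSelfAdjoint W := .of_nonneg hW0
  set R := invSqrt W with hR
  have hRsa : IsSelfAdjoint R := isSelfAdjoint_invSqrt W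
  set X := cfc Real.sqrt W
  have hX0 : 0 ≤ X := cfc_nonneg fun t _ => Real.sqrt_nonneg t
  have hXX : X ^ 2 = W := by
    rw [sq, ← cfc_mul _ _ W (continuousOn_spectrum _ _) (continuousOn_spectrum _ _)]
    conv_rhs => rw [← cfc_id' ℝ W]
    exact cfc_congr fun t ht => Real.mul_self_sqrt (spectrum_nonneg hW0 ht)
  have hRW : R * W = X := by
    conv_lhs => rw [hR, invSqrt]
    conv_lhs => arg 2; rw [← cfc_id' ℝ W]
    rw [← cfc_mul _ _ W (continuousOn_spectrum _ _) (continuousOn_spectrum _ _)]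
    refine cfc_congr fun t ht => ?_
    change (Real.sqrt t)⁻¹ * t = Real.sqrt t
    rw [inv_mul_eq_div, Real.div_sqrt]
  have hWR : W * R = X := by
    rw [← hRsa.star_eq, ← hsa.star_eq, ← star_mul, hRW]
    exact cfc_predicate Real.sqrt W
  -- `S² ≤ S ≤ W = X²`, where `S - S² = S(1-S)S + (1-S)S(1-S)`; then take square roots.
  have hSX : S ≤ X := by
    refine le_of_sq_le_sq hS hX0 ?_
    rw [hXX]
    refine le_trans ?_ (le_add_of_nonneg_right hT : S ≤ W)
    have h := add_nonneg (conj_nonneg_of_isSelfAdjoint (.of_nonneg hS) (sub_nonneg.mpr hS1))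
      (conj_nonneg_of_isSelfAdjoint ((IsSelfAdjoint.one _).sub (.of_nonneg hS)) hS)
    rw [← sub_nonneg]
    convert h using 1
    noncomm_ring
  have h1 : 0 ≤ 1 - R * W * R := sub_nonneg.mpr (invSqrt_mul_self_mul_invSqrt_le_one hW0)
  have h2 := conj_nonneg_of_isSelfAdjoint (hRsa.sub (IsSelfAdjoint.one _)) hS
  have h3 := conj_nonneg_of_isSelfAdjoint
    ((hRsa.sub (IsSelfAdjoint.one _)).sub (IsSelfAdjoint.one _)) hT
  rw [← sub_nonneg]
  -- The terms linear in `R` combine into `RW` and `WR`, both equal to `X = √W`. What is left is a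
  -- sum of four positive operators.
  have key : 2 • (1 - S) + 4 • T - (1 - R * S * R) =
      (1 - R * W * R) + 4 • (X - S) + 2 • ((R - 1) * S * (R - 1)) +
        (R - 1 - 1) * T * (R - 1 - 1) := by
    have h : 2 • (1 - S) + 4 • T - (1 - R * S * R) -
      ((1 - R * W * R) + 4 • (X - S) + 2 • ((R - 1) * S * (R - 1)) +
        (R - 1 - 1) * T * (R - 1 - 1)) = 2 • (R * W - X) + 2 • (W * R - X) := by
      rw [hW]; noncomm_ring
    rw [← sub_eq_zero, h, hRW, hWR]
    simp
  rw [key]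
  exact add_nonneg (add_nonneg (add_nonneg h1 (nsmul_nonneg (sub_nonneg.mpr hSX) 4))
    (nsmul_nonneg h2 2)) h3

theorem isStarProjection_spectralProj (M : Matrix C C ℂ) (a b : ℝ) :
    IsStarProjection (spectralProj M a b) := by
  refine ⟨?_, cfc_predicate _ M⟩
  rw [IsIdempotentElem, spectralProj, ← cfc_mul _ _ M (continuousOn_spectrum _ _)
    (continuousOn_spectrum _ _)]
  refine cfc_congr fun t _ => ?_
  by_cases ht : t ∈ Set.Icc a b <;> simp [ht]

theorem spectralProj_nonneg (M : Matrix C C ℂ) (a b : ℝ) : 0 ≤ spectralProj M a b :=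
  (isStarProjection_spectralProj M a b).nonneg

theorem spectralProj_le_one (M : Matrix C C ℂ) (a b : ℝ) : spectralProj M a b ≤ 1 :=
  (isStarProjection_spectralProj M a b).le_one

theorem spectralProj_mul_mul_spectralProj_le {M : Matrix C C ℂ} (hM : IsSelfAdjoint M)
    {a b : ℝ} (hb : 0 ≤ b) : spectralProj M a b * M * spectralProj M a b ≤ (b : ℂ) • 1 := by
  set g : ℝ → ℝ := Set.indicator (Set.Icc a b) (fun _ : ℝ => (1 : ℝ))
  have h : spectralProj M a b * M * spectralProj M a b = cfc (fun t : ℝ => g t * t * g t) M := by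
    rw [cfc_mul (fun t : ℝ => g t * t) _ M (continuousOn_spectrum _ _)
      (continuousOn_spectrum _ _), cfc_mul _ (fun t : ℝ => t) M (continuousOn_spectrum _ _)
      (continuousOn_spectrum _ _), cfc_id' ℝ M, spectralProj]
  have h' : ((b : ℂ) • 1 : Matrix C C ℂ) = algebraMap ℝ _ b := by
    rw [Algebra.algebraMap_eq_smul_one]; simp
  rw [h, h']
  refine cfc_le_algebraMap _ _ _ (fun t _ => ?_) (continuousOn_spectrum _ _)
  by_cases ht : t ∈ Set.Icc a b
  · simpa [g, ht] using ht.2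
  · simpa [g, ht] using hb

/-- Taking traces, this bounds the rank of `Π_x` by `1/a`, since `Tr ρ_x = 1`. -/
theorem smul_spectralProj_le {M : Matrix C C ℂ} (hM : 0 ≤ M) {a : ℝ} (b : ℝ) :
    (a : ℂ) • spectralProj M a b ≤ M := by
  have hsa : IsSelfAdjoint M := .of_nonneg hM
  set g : ℝ → ℝ := Set.indicator (Set.Icc a b) (fun _ : ℝ => (1 : ℝ)) with hg
  have h : (a : ℂ) • spectralProj M a b = cfc (fun t : ℝ => a * g t) M := by
    rw [cfc_const_mul _ _ _ (continuousOn_spectrum _ _), spectralProj]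
    simp [g]
  rw [h]
  conv_rhs => rw [← cfc_id' ℝ M]
  refine cfc_mono (fun t ht => ?_) (continuousOn_spectrum _ _) (continuousOn_spectrum _ _)
  have ht0 := spectrum_nonneg hM ht
  by_cases ht : t ∈ Set.Icc a b
  · simpa [g, ht] using ht.1
  · simpa [g, ht] using ht0

end Matrix
-- Weak law of large numbers for finite product weights.
section LawOfLargeNumbers

variable {Ω : Type*} [Fintype Ω]

theorem sum_prod_apply {R : Type*} [CommSemiring R] {n : ℕ} (f : Fin n → Ω → R) :
    ∑ ω : Fin n → Ω, ∏ i, f i (ω i) = ∏ i, ∑ o, f i o := by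
  rw [Finset.prod_univ_sum, Fintype.piFinset_univ]

theorem sum_prod_weights {w : Ω → ℝ} (hw : ∑ o, w o = 1) (n : ℕ) :
    ∑ ω : Fin n → Ω, ∏ i, w (ω i) = 1 := by
  rw [sum_prod_apply fun _ => w]
  simp [hw]

theorem sum_fin_succ_arrow {n : ℕ} (F : (Fin (n + 1) → Ω) → ℝ) :
    ∑ ω, F ω = ∑ o, ∑ ω : Fin n → Ω, F (Fin.cons o ω) := by
  rw [← (Fin.consEquiv fun _ : Fin (n + 1) => Ω).sum_comp, Fintype.sum_prod_type]
  rfl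

theorem sum_prod_weights_mul_sum {w Y : Ω → ℝ} (hw : ∑ o, w o = 1) (hY : ∑ o, w o * Y o = 0)
    (n : ℕ) : ∑ ω : Fin n → Ω, (∏ i, w (ω i)) * ∑ i, Y (ω i) = 0 := by
  induction n with
  | zero => simp
  | succ n ih =>
    rw [sum_fin_succ_arrow]
    have h : ∀ o, ∑ ω : Fin n → Ω, (∏ i, w (Fin.cons (α := fun _ => Ω) o ω i)) *
        ∑ i, Y (Fin.cons (α := fun _ => Ω) o ω i) = w o * Y o := by
      intro o
      have h' : ∀ ω : Fin n → Ω, (∏ i, w (Fin.cons (α := fun _ => Ω) o ω i)) *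
          ∑ i, Y (Fin.cons (α := fun _ => Ω) o ω i) =
          w o * Y o * (∏ i, w (ω i)) + w o * ((∏ i, w (ω i)) * ∑ i, Y (ω i)) := by
        intro ω
        simp only [Fin.prod_univ_succ, Fin.sum_univ_succ, Fin.cons_zero, Fin.cons_succ]
        ring
      simp only [h', Finset.sum_add_distrib, ← Finset.mul_sum, ih, sum_prod_weights hw]
      ring
    simp only [h, hY]

/-- Additivity of variance: splitting off the first letter, the cross term vanishes because `Y` is
centred. -/
theorem sum_prod_weights_mul_sum_sq {w Y : Ω → ℝ} (hw : ∑ o, w o = 1)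
    (hY : ∑ o, w o * Y o = 0) (n : ℕ) :
    ∑ ω : Fin n → Ω, (∏ i, w (ω i)) * (∑ i, Y (ω i)) ^ 2 = n * ∑ o, w o * Y o ^ 2 := by
  induction n with
  | zero => simp
  | succ n ih =>
    rw [sum_fin_succ_arrow]
    have h : ∀ o, ∑ ω : Fin n → Ω, (∏ i, w (Fin.cons (α := fun _ => Ω) o ω i)) *
        (∑ i, Y (Fin.cons (α := fun _ => Ω) o ω i)) ^ 2 =
        w o * Y o ^ 2 + w o * (n * ∑ o, w o * Y o ^ 2) := by
      intro o
      have h' : ∀ ω : Fin n → Ω, (∏ i, w (Fin.cons (α := fun _ => Ω) o ω i)) *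
          (∑ i, Y (Fin.cons (α := fun _ => Ω) o ω i)) ^ 2 =
          w o * Y o ^ 2 * (∏ i, w (ω i)) + 2 * w o * Y o * ((∏ i, w (ω i)) * ∑ i, Y (ω i)) +
            w o * ((∏ i, w (ω i)) * (∑ i, Y (ω i)) ^ 2) := by
        intro ω
        simp only [Fin.prod_univ_succ, Fin.sum_univ_succ, Fin.cons_zero, Fin.cons_succ]
        ring
      simp only [h', Finset.sum_add_distrib, ← Finset.mul_sum, ih, sum_prod_weights hw,
        sum_prod_weights_mul_sum hw hY]
      ring
    simp only [h, Finset.sum_add_distrib, ← Finset.sum_mul, hw]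
    push_cast
    ring

/-- The indicator function of the interval of probabilities regarded as typical for blocks of
length `n` and entropy rate `h`. -/
noncomputable def typInd (h δ : ℝ) (n : ℕ) : ℝ → ℝ :=
  Set.indicator (Set.Icc ((2 : ℝ) ^ (-(n : ℝ) * (h + δ))) ((2 : ℝ) ^ (-(n : ℝ) * (h - δ))))
    fun _ => 1

/-- The probability that the product of `g` along an i.i.d. block with letter distribution `w` is
not typical. -/
noncomputable def atypicalMass (w g : Ω → ℝ) (h δ : ℝ) (n : ℕ) : ℝ :=
  ∑ ω : Fin n → Ω, (∏ i, w (ω i)) * (1 - typInd h δ n (∏ i, g (ω i)))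

/-- The pointwise form of Chebyshev: after taking logarithms, an atypical product is a deviation of
at least `nδ`. -/
theorem one_sub_typInd_mul_le {n : ℕ} {g : Fin n → ℝ} (hg : ∀ i, 0 < g i) (h : ℝ) {δ : ℝ}
    (hδ : 0 < δ) :
    (1 - typInd h δ n (∏ i, g i)) * (n * δ) ^ 2 ≤ (∑ i, (-Real.logb 2 (g i) - h)) ^ 2 := by
  by_cases ht : ∏ i, g i ∈ Set.Icc ((2 : ℝ) ^ (-(n : ℝ) * (h + δ)))
      ((2 : ℝ) ^ (-(n : ℝ) * (h - δ)))
  · simp only [typInd, ht, Set.indicator_of_mem, sub_self, zero_mul]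
    positivity
  · simp only [typInd, ht, not_false_eq_true, Set.indicator_of_notMem, sub_zero, one_mul]
    rw [sq_le_sq, abs_of_nonneg (by positivity : 0 ≤ (n : ℝ) * δ)]
    contrapose! ht
    have hsum : ∑ i, (-Real.logb 2 (g i) - h) = -Real.logb 2 (∏ i, g i) - n * h := by
      rw [Real.logb_prod _ _ fun i _ => (hg i).ne']
      simp
    have hpos : 0 < ∏ i, g i := Finset.prod_pos fun i _ => hg i
    rw [hsum, abs_lt] at ht
    refine ⟨?_, ?_⟩
    · rw [← Real.le_logb_iff_rpow_le one_lt_two hpos]; linarith [ht.2]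
    · rw [← Real.logb_le_iff_le_rpow one_lt_two hpos]; linarith [ht.1]

theorem atypicalMass_nonneg {w : Ω → ℝ} (hw : ∀ o, 0 ≤ w o) (g : Ω → ℝ) (h δ : ℝ) (n : ℕ) :
    0 ≤ atypicalMass w g h δ n :=
  Finset.sum_nonneg fun _ _ => mul_nonneg (Finset.prod_nonneg fun _ _ => hw _)
    (sub_nonneg.mpr (Set.indicator_le' (fun _ _ => le_rfl) (fun _ _ => zero_le_one) _))

/-- Chebyshev gives the bound `V/(nδ²)`. The weight `w` and the factor `g` are kept separate because
for `Π_x` the letters follow a joint law while only the conditional eigenvalues are multiplied. -/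
theorem tendsto_atypicalMass {w g : Ω → ℝ} (hw : ∀ o, 0 ≤ w o) (hw1 : ∑ o, w o = 1)
    (hg : ∀ o, w o ≠ 0 → 0 < g o) {h : ℝ} (hh : h = -∑ o, w o * Real.logb 2 (g o)) {δ : ℝ}
    (hδ : 0 < δ) :
    Filter.Tendsto (atypicalMass w g h δ) Filter.atTop (nhds 0) := by
  set Y : Ω → ℝ := fun o => -Real.logb 2 (g o) - h with hYdef
  have hY : ∑ o, w o * Y o = 0 := by
    simp only [hYdef, mul_sub, mul_neg, Finset.sum_sub_distrib, ← Finset.sum_mul, hw1,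
      Finset.sum_neg_distrib]
    rw [hh]; ring
  set V := ∑ o, w o * Y o ^ 2
  have hbound : ∀ n : ℕ, atypicalMass w g h δ n * (n * δ) ^ 2 ≤ n * V := by
    intro n
    rw [← sum_prod_weights_mul_sum_sq hw1 hY n, atypicalMass, Finset.sum_mul]
    refine Finset.sum_le_sum fun ω _ => ?_
    rw [mul_assoc]
    -- A letter of weight 0 may have `g = 0` and a meaningless logarithm, but its words contribute
    -- nothing.
    by_cases h0 : ∏ i, w (ω i) = 0
    · simp [h0]
    · rw [← ne_eq, Finset.prod_ne_zero_iff] at h0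
      exact mul_le_mul_of_nonneg_left
        (one_sub_typInd_mul_le (fun i => hg _ (h0 i (Finset.mem_univ i))) h hδ)
        (Finset.prod_nonneg fun i _ => hw _)
  have hlim : Filter.Tendsto (fun n : ℕ => V / δ ^ 2 / (n : ℝ)) Filter.atTop (nhds 0) :=
    tendsto_const_div_atTop_nhds_zero_nat _
  refine squeeze_zero' (Filter.Eventually.of_forall fun n => atypicalMass_nonneg hw g h δ n) ?_ hlim
  filter_upwards [Filter.eventually_gt_atTop 0] with n hn
  have hn' : (0 : ℝ) < n := Nat.cast_pos.mpr hn
  rw [div_div, le_div_iff₀ (by positivity)]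
  have := hbound n
  refine le_of_mul_le_mul_left ?_ hn'
  linarith

end LawOfLargeNumbers

/-! ### Tensor products and their spectra. -/

section Tensor

variable {B : Type*} {n : ℕ}

theorem tensor_mul [Fintype B] (M N : Fin n → Matrix B B ℂ) :
    tensor M * tensor N = tensor fun i => M i * N i := by
  ext b b'
  simp only [tensor, Matrix.mul_apply, Matrix.of_apply, ← Finset.prod_mul_distrib]
  exact sum_prod_apply fun i c => M i (b i) c * N i c (b' i)

theorem star_tensor (M : Fin n → Matrix B B ℂ) : star (tensor M) = tensor fun i => star (M i) := by
  ext b b'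
  simp [tensor, Matrix.star_apply]

theorem tensor_diagonal [DecidableEq B] (d : Fin n → B → ℝ) :
    tensor (fun i => Matrix.diagonal fun c => (d i c : ℂ))
      = Matrix.diagonal fun b => ((∏ i, d i (b i) : ℝ) : ℂ) := by
  ext b b'
  simp only [tensor, Matrix.of_apply]
  by_cases h : b = b'
  · subst h; simp
  · obtain ⟨i, hi⟩ := Function.ne_iff.mp h
    rw [Matrix.diagonal_apply_ne _ h]
    exact Finset.prod_eq_zero (Finset.mem_univ i) (Matrix.diagonal_apply_ne _ hi)

theorem tensor_one [DecidableEq B] : tensor (fun _ : Fin n => (1 : Matrix B B ℂ)) = 1 := by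
  simpa using tensor_diagonal (n := n) fun _ (_ : B) => 1

theorem trace_tensor [Fintype B] (M : Fin n → Matrix B B ℂ) :
    (tensor M).trace = ∏ i, (M i).trace := by
  simp only [Matrix.trace, tensor, Matrix.diag_apply, Matrix.of_apply]
  exact sum_prod_apply fun i c => M i c c

theorem tensor_nonneg [Fintype B] [DecidableEq B] {M : Fin n → Matrix B B ℂ} (hM : ∀ i, 0 ≤ M i) :
    0 ≤ tensor M := by
  choose X hX using fun i => CStarAlgebra.nonneg_iff_eq_star_mul_self.mp (hM i)
  have h : tensor M = star (tensor X) * tensor X := by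
    rw [star_tensor, tensor_mul]
    exact congrArg tensor (funext hX)
  rw [h]
  exact star_mul_self_nonneg _

variable [Fintype B] [DecidableEq B]

/-- The spectral decomposition of a tensor product. -/
theorem tensor_eq_unitary_conj_diagonal {M : Fin n → Matrix B B ℂ}
    (hM : ∀ i, (M i).IsHermitian) :
    ∃ U : Matrix (Fin n → B) (Fin n → B) ℂ, star U * U = 1 ∧
      tensor M = U * Matrix.diagonal
        (fun b => ((∏ i, (hM i).eigenvalues (b i) : ℝ) : ℂ)) * star U := by
  refine ⟨tensor fun i => (hM i).eigenvectorUnitary, ?_, ?_⟩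
  · rw [star_tensor, tensor_mul, ← tensor_one]
    simp
  · rw [← tensor_diagonal (fun i => (hM i).eigenvalues), star_tensor, tensor_mul, tensor_mul]
    congr 1
    funext i
    exact (hM i).spectral_theorem

theorem re_trace_cfc_unitary_conj_diagonal {C : Type*} [Fintype C] [DecidableEq C]
    {U : Matrix C C ℂ} (hU : star U * U = 1) (d : C → ℝ) (f : ℝ → ℝ) :
    ((cfc f (U * Matrix.diagonal (fun c => (d c : ℂ)) * star U)).trace).re = ∑ c, f (d c) := by
  rw [cfc_unitary_conj_diagonal hU, Matrix.trace_mul_comm, ← mul_assoc, hU, one_mul,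
    Matrix.trace_diagonal]
  simp

theorem re_trace_cfc_tensor {M : Fin n → Matrix B B ℂ} (hM : ∀ i, (M i).IsHermitian)
    (f : ℝ → ℝ) :
    ((cfc f (tensor M)).trace).re = ∑ b : Fin n → B, f (∏ i, (hM i).eigenvalues (b i)) := by
  obtain ⟨U, hU, h⟩ := tensor_eq_unitary_conj_diagonal hM
  rw [h, re_trace_cfc_unitary_conj_diagonal hU]

theorem vonNeumannEntropy_eq {C : Type*} [Fintype C] [DecidableEq C] {M : Matrix C C ℂ}
    (hM : M.IsHermitian) :
    vonNeumannEntropy M = -∑ c, hM.eigenvalues c * Real.logb 2 (hM.eigenvalues c) := by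
  rw [vonNeumannEntropy]
  conv_lhs => rw [hM.spectral_theorem]
  exact congrArg Neg.neg (re_trace_cfc_unitary_conj_diagonal
    (Unitary.coe_star_mul_self hM.eigenvectorUnitary) hM.eigenvalues _)

/-- The bridge from quantum to classical typicality: in a product eigenbasis only products of
eigenvalues remain. -/
theorem re_trace_tensor_mul_one_sub_spectralProj {M : Fin n → Matrix B B ℂ}
    (hM : ∀ i, (M i).IsHermitian) (h δ : ℝ) :
    ((tensor M * (1 - spectralProj (tensor M) ((2 : ℝ) ^ (-(n : ℝ) * (h + δ)))
      ((2 : ℝ) ^ (-(n : ℝ) * (h - δ))))).trace).re =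
      ∑ b : Fin n → B, (∏ i, (hM i).eigenvalues (b i)) *
        (1 - typInd h δ n (∏ i, (hM i).eigenvalues (b i))) := by
  rw [← re_trace_cfc_tensor hM fun t => t * (1 - typInd h δ n t)]
  have hsa : IsSelfAdjoint (tensor M) := by
    rw [IsSelfAdjoint, star_tensor]
    exact congrArg tensor (funext fun i => hM i)
  rw [cfc_mul (fun t => t) (fun t => 1 - typInd h δ n t) _ (continuousOn_spectrum _ _)
    (continuousOn_spectrum _ _), cfc_sub (fun _ => 1) _ _ (continuousOn_spectrum _ _)
    (continuousOn_spectrum _ _), cfc_id' ℝ (tensor M), cfc_const_one ℝ (tensor M)]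
  rfl

end Tensor

/-! ### Block states, the decoding operators and the packing bound. -/

namespace Ensemble

variable {A B : Type*} [Fintype A] [Fintype B] (E : Ensemble A B) {n : ℕ}

theorem avg_nonneg : 0 ≤ E.avg :=
  Finset.sum_nonneg fun a _ => Matrix.nonneg_iff_posSemidef.mpr
    ((E.ρ_posSemidef a).smul (Complex.zero_le_real.mpr (E.p_nonneg a)))

theorem trace_avg : E.avg.trace = 1 := by
  simp only [avg, Matrix.trace_sum, Matrix.trace_smul, E.ρ_trace, smul_eq_mul, mul_one]
  exact_mod_cast E.p_sum

theorem blockProb_nonneg (x : Fin n → A) : 0 ≤ E.blockProb x :=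
  Finset.prod_nonneg fun i _ => E.p_nonneg (x i)

theorem sum_blockProb : ∑ x : Fin n → A, E.blockProb x = 1 :=
  sum_prod_weights E.p_sum n

theorem trace_blockState (x : Fin n → A) : (E.blockState x).trace = 1 := by
  simp [blockState, trace_tensor, E.ρ_trace]

theorem sum_blockProb_smul_blockState :
    ∑ x : Fin n → A, (E.blockProb x : ℂ) • E.blockState x = tensor fun _ => E.avg := by
  ext b b'
  simp only [Matrix.sum_apply, Matrix.smul_apply, blockProb, blockState, tensor, Matrix.of_apply,
    avg, smul_eq_mul, Complex.ofReal_prod, ← Finset.prod_mul_distrib]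
  exact sum_prod_apply fun i a => (E.p a : ℂ) * E.ρ a (b i) (b' i)

theorem sum_blockProb_mul_re_trace (M : Matrix (Fin n → B) (Fin n → B) ℂ) :
    ∑ x : Fin n → A, E.blockProb x * ((E.blockState x * M).trace).re =
      (((tensor fun _ => E.avg) * M).trace).re := by
  rw [← sum_blockProb_smul_blockState, Finset.sum_mul, Matrix.trace_sum, Complex.re_sum]
  simp [Matrix.trace_smul]

variable [DecidableEq B] (δ : ℝ)

theorem blockState_nonneg (x : Fin n → A) : 0 ≤ E.blockState x :=
  tensor_nonneg fun i => Matrix.nonneg_iff_posSemidef.mpr (E.ρ_posSemidef (x i))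

theorem isStarProjection_typProj : IsStarProjection (E.typProj δ n) :=
  isStarProjection_spectralProj _ _ _

theorem condTypProj_nonneg (x : Fin n → A) : 0 ≤ E.condTypProj δ x :=
  spectralProj_nonneg _ _ _

theorem condTypProj_le_one (x : Fin n → A) : E.condTypProj δ x ≤ 1 :=
  spectralProj_le_one _ _ _

theorem Λ_nonneg (x : Fin n → A) : 0 ≤ E.Λ δ x := by
  unfold Λ
  split_ifs
  · exact conj_nonneg_of_isSelfAdjoint (E.isStarProjection_typProj δ).2 (E.condTypProj_nonneg δ x)
  · exact le_rfl

theorem Λ_le_one (x : Fin n → A) : E.Λ δ x ≤ 1 := by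
  unfold Λ
  split_ifs
  · have hP := E.isStarProjection_typProj (n := n) δ
    have h := conj_nonneg_of_isSelfAdjoint hP.2 (sub_nonneg.mpr (E.condTypProj_le_one δ x))
    rw [mul_sub, mul_one, sub_mul, hP.1, sub_nonneg] at h
    exact h.trans hP.le_one
  · exact zero_le_one

/-- For typical `x` this is `one_sub_conj_le`; otherwise `Λ_x = 0` and the first term is already
`1`. -/
theorem one_sub_Λ_le (x : Fin n → A) :
    1 - E.Λ δ x ≤ ((1 - typInd E.H δ n (E.blockProb x) : ℝ) : ℂ) • 1 +
      (3 • (1 - E.typProj δ n) + 2 • (1 - E.condTypProj δ x)) := by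
  have hP := E.isStarProjection_typProj (n := n) δ
  unfold Λ
  split_ifs with hx
  · have : typInd E.H δ n (E.blockProb x) = 1 := Set.indicator_of_mem hx _
    rw [this, sub_self, Complex.ofReal_zero, zero_smul, zero_add]
    exact one_sub_conj_le hP (E.condTypProj_nonneg δ x) (E.condTypProj_le_one δ x)
  · have : typInd E.H δ n (E.blockProb x) = 0 := Set.indicator_of_notMem hx _
    rw [this, sub_zero, sub_zero, Complex.ofReal_one, one_smul]
    exact le_add_of_nonneg_right (add_nonneg (nsmul_nonneg (sub_nonneg.mpr hP.le_one) 3)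
      (nsmul_nonneg (sub_nonneg.mpr (E.condTypProj_le_one δ x)) 2))

section POVM

variable {Y : Type*} [DecidableEq Y] (f : (Fin n → A) → Y)

theorem T_nonneg (h : Y) : 0 ≤ E.T δ f h :=
  Finset.sum_nonneg fun y _ => E.Λ_nonneg δ y

theorem povm_nonneg (y : Fin n → A) : 0 ≤ E.povm δ f y :=
  conj_nonneg_of_isSelfAdjoint (isSelfAdjoint_invSqrt _) (E.Λ_nonneg δ y)

theorem sum_povm_le_one (h : Y) : ∑ y with f y = h, E.povm δ f y ≤ 1 := by
  have : ∑ y with f y = h, E.povm δ f y =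
      invSqrt (E.T δ f h) * E.T δ f h * invSqrt (E.T δ f h) := by
    conv_rhs => arg 1; arg 2; rw [T]
    rw [Finset.mul_sum, Finset.sum_mul]
    refine Finset.sum_congr rfl fun y hy => ?_
    rw [povm, (Finset.mem_filter.mp hy).2]
  rw [this]
  exact invSqrt_mul_self_mul_invSqrt_le_one (E.T_nonneg δ f h)

theorem povm_le_one (y : Fin n → A) : E.povm δ f y ≤ 1 :=
  (Finset.single_le_sum (fun z _ => E.povm_nonneg δ f z) (by simp)).trans
    (E.sum_povm_le_one δ f (f y))

theorem errorGiven_nonneg : 0 ≤ E.errorGiven δ f :=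
  Finset.sum_nonneg fun x _ => mul_nonneg (E.blockProb_nonneg x)
    (re_trace_mul_nonneg (E.blockState_nonneg x) (sub_nonneg.mpr (E.povm_le_one δ f x)))

open Classical in
-- Hayashi–Nagaoka with `S = Λ_x` and `T` the sum of the `Λ_y` over the other words colliding with
-- `x`.
theorem re_trace_blockState_mul_one_sub_povm_le (x : Fin n → A) :
    ((E.blockState x * (1 - E.povm δ f x)).trace).re ≤
      2 * ((E.blockState x * (1 - E.Λ δ x)).trace).re +
        4 * ∑ y with y ≠ x, if f x = f y then ((E.blockState x * E.Λ δ y).trace).re else 0 := by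
  set N := ∑ y with y ≠ x, if f x = f y then E.Λ δ y else 0 with hN
  have hN0 : 0 ≤ N := Finset.sum_nonneg fun y _ => by
    split_ifs
    · exact E.Λ_nonneg δ y
    · exact le_rfl
  have hT : E.T δ f (f x) = E.Λ δ x + N := by
    rw [T, Finset.sum_filter, hN, ← Finset.add_sum_erase _ _ (Finset.mem_univ x), if_pos rfl]
    congr 1
    refine Finset.sum_congr (by ext; simp) fun y _ => by simp only [eq_comm]
  have h := re_trace_mul_le_re_trace_mul (E.blockState_nonneg x)
    (one_sub_invSqrt_conj_le (E.Λ_nonneg δ x) (E.Λ_le_one δ x) hN0)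
  rw [← hT, mul_add, mul_smul_comm, mul_smul_comm, Matrix.trace_add, Complex.add_re] at h
  refine h.trans (le_of_eq ?_)
  rw [hN, Finset.mul_sum]
  simp only [Matrix.trace_smul, Matrix.trace_sum]
  simp [apply_ite, Complex.re_sum]

end POVM

/-- The part of the error bound caused by atypical behaviour of the source. -/
noncomputable def atypicalError (n : ℕ) : ℝ :=
  ∑ x : Fin n → A, E.blockProb x * ((E.blockState x * (1 - E.Λ δ x)).trace).re

/-- For typical `y`, `Π ρ^{⊗n} Π ≤ 2^{-n(S-δ)}` and `Tr Π_y ≤ 2^{n(S̄+δ)}` bound the trace by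
`2^{-n(χ-2δ)}`. Typicality, `p_y ≥ 2^{-n(H+δ)}`, brings in the factor `p_y`, so summing over `y`
needs no count of typical words. -/
theorem re_trace_tensor_avg_mul_Λ_le (y : Fin n → A) :
    (((tensor fun _ => E.avg) * E.Λ δ y).trace).re ≤
      E.blockProb y * (2 : ℝ) ^ ((n : ℝ) * (E.H - E.χ + 3 * δ)) := by
  unfold Λ
  split_ifs with hy
  · set P := E.typProj δ n
    set Q := E.condTypProj δ y
    set R := tensor fun _ : Fin n => E.avg
    set b := (2 : ℝ) ^ (-(n : ℝ) * (vonNeumannEntropy E.avg - δ))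
    set a := (2 : ℝ) ^ (-(n : ℝ) * (E.condEntropy + δ))
    have ha : 0 < a := by positivity
    have hb : 0 < b := by positivity
    have h1 : ((R * (P * Q * P)).trace).re ≤ b * (Q.trace).re := by
      have hc : (R * (P * Q * P)).trace = (Q * (P * R * P)).trace := by
        rw [show R * (P * Q * P) = (R * P) * (Q * P) by noncomm_ring, Matrix.trace_mul_comm,
          show Q * P * (R * P) = Q * (P * R * P) by noncomm_ring]
      rw [hc]
      refine (re_trace_mul_le_re_trace_mul (E.condTypProj_nonneg δ y)
        (spectralProj_mul_mul_spectralProj_le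
          (.of_nonneg (tensor_nonneg fun _ => E.avg_nonneg)) hb.le)).trans (le_of_eq ?_)
      rw [mul_smul_comm, mul_one, Matrix.trace_smul, smul_eq_mul, Complex.re_ofReal_mul]
    have h2 : a * (Q.trace).re ≤ 1 := by
      have h := re_trace_mul_le_re_trace_mul
        (R := (1 : Matrix (Fin n → B) (Fin n → B) ℂ)) zero_le_one
        (smul_spectralProj_le (E.blockState_nonneg y) (a := a)
          ((2 : ℝ) ^ (-(n : ℝ) * (E.condEntropy - δ))))
      rw [one_mul, one_mul, E.trace_blockState, Matrix.trace_smul, smul_eq_mul,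
        Complex.re_ofReal_mul, Complex.one_re] at h
      exact h
    have h3 : (2 : ℝ) ^ (-(n : ℝ) * (E.H + δ)) ≤ E.blockProb y := hy.1
    have h4 : (Q.trace).re ≤ a⁻¹ := by
      rwa [← one_div, le_div_iff₀ ha, mul_comm]
    calc ((R * (P * Q * P)).trace).re ≤ b * a⁻¹ := h1.trans (by gcongr)
      _ = (2 : ℝ) ^ (-(n : ℝ) * (E.H + δ)) * (2 : ℝ) ^ ((n : ℝ) * (E.H - E.χ + 3 * δ)) := by
        rw [← Real.rpow_neg zero_le_two, ← Real.rpow_add two_pos, ← Real.rpow_add two_pos, χ]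
        congr 1
        ring
      _ ≤ _ := by gcongr
  · rw [mul_zero, Matrix.trace_zero, Complex.zero_re]
    exact mul_nonneg (E.blockProb_nonneg y) (by positivity)

theorem sum_re_trace_tensor_avg_mul_Λ_le :
    ∑ y : Fin n → A, (((tensor fun _ => E.avg) * E.Λ δ y).trace).re ≤
      (2 : ℝ) ^ ((n : ℝ) * (E.H - E.χ + 3 * δ)) := by
  refine (Finset.sum_le_sum fun y _ => E.re_trace_tensor_avg_mul_Λ_le δ y).trans (le_of_eq ?_)
  rw [← Finset.sum_mul, E.sum_blockProb, one_mul]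

end Ensemble

open Ensemble

/-! ### Averaging over the random hash. -/

section AverageError

variable {A B : Type*} [Fintype A] [Fintype B] [DecidableEq B] (E : Ensemble A B) (δ : ℝ) {n : ℕ}
  {Y K : Type*} [Fintype K] [DecidableEq Y]

theorem avgError_nonneg (F : RandomHash (Fin n → A) Y K) : 0 ≤ avgError E δ F :=
  Finset.sum_nonneg fun k _ => mul_nonneg (F.q_nonneg k) (E.errorGiven_nonneg δ _)

open Classical in
theorem avgError_le [Fintype Y] {F : RandomHash (Fin n → A) Y K} (hF : F.IsTwoUniversal) :
    avgError E δ F ≤ 2 * E.atypicalError δ n +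
      4 * (2 : ℝ) ^ ((n : ℝ) * (E.H - E.χ + 3 * δ)) / (Fintype.card Y : ℝ) := by
  set t : (Fin n → A) → (Fin n → A) → ℝ := fun x y => ((E.blockState x * E.Λ δ y).trace).re
  have ht : ∀ x y, 0 ≤ t x y := fun x y =>
    re_trace_mul_nonneg (E.blockState_nonneg x) (E.Λ_nonneg δ y)
  have hcard : (0 : ℝ) ≤ 1 / (Fintype.card Y : ℝ) := by positivity
  have h1 : ∀ k, E.errorGiven δ (F.f k) ≤ 2 * E.atypicalError δ n +
      4 * ∑ x, ∑ y with y ≠ x, E.blockProb x * (if F.f k x = F.f k y then t x y else 0) := by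
    intro k
    rw [errorGiven, atypicalError, Finset.mul_sum, Finset.mul_sum, ← Finset.sum_add_distrib]
    refine Finset.sum_le_sum fun x _ => ?_
    refine (mul_le_mul_of_nonneg_left (E.re_trace_blockState_mul_one_sub_povm_le δ (F.f k) x)
      (E.blockProb_nonneg x)).trans (le_of_eq ?_)
    rw [← Finset.mul_sum]
    ring
  -- With the sum over seeds moved inside, each pair `x ≠ y` carries exactly its collision
  -- probability.
  have h2 : ∑ k, F.q k *
      ∑ x, ∑ y with y ≠ x, E.blockProb x * (if F.f k x = F.f k y then t x y else 0) ≤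
      1 / (Fintype.card Y : ℝ) * ∑ x, ∑ y with y ≠ x, E.blockProb x * t x y := by
    simp only [Finset.mul_sum]
    rw [Finset.sum_comm]
    refine Finset.sum_le_sum fun x _ => ?_
    rw [Finset.sum_comm]
    refine Finset.sum_le_sum fun y hy => ?_
    have h := mul_le_mul_of_nonneg_right (hF x y (Finset.mem_filter.mp hy).2.symm)
      (mul_nonneg (E.blockProb_nonneg x) (ht x y))
    refine le_trans (le_of_eq ?_) h
    rw [Finset.sum_filter, Finset.sum_mul]
    refine Finset.sum_congr rfl fun k _ => ?_
    split_ifs <;> ring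
  have h3 : ∑ x, ∑ y with y ≠ x, E.blockProb x * t x y ≤
      (2 : ℝ) ^ ((n : ℝ) * (E.H - E.χ + 3 * δ)) := by
    calc ∑ x, ∑ y with y ≠ x, E.blockProb x * t x y
        ≤ ∑ x, ∑ y, E.blockProb x * t x y := Finset.sum_le_sum fun x _ =>
          Finset.sum_le_sum_of_subset_of_nonneg (Finset.filter_subset _ _)
            fun y _ _ => mul_nonneg (E.blockProb_nonneg x) (ht x y)
      _ = ∑ y : Fin n → A, (((tensor fun _ => E.avg) * E.Λ δ y).trace).re := by
        rw [Finset.sum_comm]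
        exact Finset.sum_congr rfl fun y _ => E.sum_blockProb_mul_re_trace _
      _ ≤ _ := E.sum_re_trace_tensor_avg_mul_Λ_le δ
  calc avgError E δ F
      ≤ ∑ k, F.q k * (2 * E.atypicalError δ n + 4 *
        ∑ x, ∑ y with y ≠ x, E.blockProb x * (if F.f k x = F.f k y then t x y else 0)) :=
        Finset.sum_le_sum fun k _ => mul_le_mul_of_nonneg_left (h1 k) (F.q_nonneg k)
    _ = 2 * E.atypicalError δ n + 4 * ∑ k, F.q k *
        ∑ x, ∑ y with y ≠ x, E.blockProb x * (if F.f k x = F.f k y then t x y else 0) := by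
        simp only [mul_add, Finset.sum_add_distrib, ← Finset.sum_mul, F.q_sum, one_mul]
        rw [Finset.mul_sum]
        congr 1
        exact Finset.sum_congr rfl fun k _ => by ring
    _ ≤ 2 * E.atypicalError δ n + 4 * (1 / (Fintype.card Y : ℝ) *
        (2 : ℝ) ^ ((n : ℝ) * (E.H - E.χ + 3 * δ))) := by
        gcongr
        exact h2.trans (mul_le_mul_of_nonneg_left h3 hcard)
    _ = _ := by ring

end AverageError

/-! ### Limits in the block length. -/

section Asymptotics

variable {A B : Type*} [Fintype A] [Fintype B] [DecidableEq B] (E : Ensemble A B) {δ : ℝ}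

theorem sum_eigenvalues_eq_one {M : Matrix B B ℂ} (hM : M.IsHermitian) (h : M.trace = 1) :
    ∑ b, hM.eigenvalues b = 1 := by
  have := hM.trace_eq_sum_eigenvalues
  rw [h] at this
  simpa using (congrArg Complex.re this).symm

theorem tendsto_re_trace_tensor_avg (hδ : 0 < δ) :
    Filter.Tendsto (fun n : ℕ => (((tensor fun _ : Fin n => E.avg) *
      (1 - E.typProj δ n)).trace).re) Filter.atTop (nhds 0) := by
  have hps : E.avg.PosSemidef := Matrix.nonneg_iff_posSemidef.mp E.avg_nonneg
  refine (tendsto_atypicalMass (w := hps.isHermitian.eigenvalues)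
    (g := hps.isHermitian.eigenvalues) hps.eigenvalues_nonneg
    (sum_eigenvalues_eq_one _ E.trace_avg)
    (fun b hb => (hps.eigenvalues_nonneg b).lt_of_ne' hb)
    (vonNeumannEntropy_eq hps.isHermitian) hδ).congr fun n => ?_
  exact (re_trace_tensor_mul_one_sub_spectralProj (fun _ => hps.isHermitian) _ _).symm

/-- Drawing a letter `a` and then an eigenvector of `ρ_a` gives i.i.d. pairs with law `p_a e_a(b)`,
and the mean of `-log₂ e_a(b)` is the average entropy. -/
theorem tendsto_sum_re_trace_condTypProj (hδ : 0 < δ) :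
    Filter.Tendsto (fun n : ℕ => ∑ x : Fin n → A, E.blockProb x *
      ((E.blockState x * (1 - E.condTypProj δ x)).trace).re) Filter.atTop (nhds 0) := by
  set e : A → B → ℝ := fun a => (E.ρ_posSemidef a).isHermitian.eigenvalues
  have he : ∀ a b, 0 ≤ e a b := fun a => (E.ρ_posSemidef a).eigenvalues_nonneg
  have he1 : ∀ a, ∑ b, e a b = 1 := fun a => sum_eigenvalues_eq_one _ (E.ρ_trace a)
  refine (tendsto_atypicalMass (w := fun o : A × B => E.p o.1 * e o.1 o.2)
    (g := fun o => e o.1 o.2) (h := E.condEntropy)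
    (fun o => mul_nonneg (E.p_nonneg _) (he _ _)) ?_
    (fun o ho => (he _ _).lt_of_ne' (right_ne_zero_of_mul ho)) ?_ hδ).congr fun n => ?_
  · simp only [Fintype.sum_prod_type, ← Finset.mul_sum, he1, mul_one, E.p_sum]
  · simp only [Fintype.sum_prod_type, mul_assoc, ← Finset.mul_sum, condEntropy,
      ← Finset.sum_neg_distrib, ← mul_neg]
    refine Finset.sum_congr rfl fun a _ => ?_
    rw [vonNeumannEntropy_eq (E.ρ_posSemidef a).isHermitian]
    simp [e]
  · rw [atypicalMass,
      ← (Equiv.arrowProdEquivProdArrow (Fin n) (fun _ => A) (fun _ => B)).symm.sum_comp,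
      Fintype.sum_prod_type]
    refine Finset.sum_congr rfl fun x _ => ?_
    rw [blockState, condTypProj, blockState, re_trace_tensor_mul_one_sub_spectralProj
      (fun i => (E.ρ_posSemidef (x i)).isHermitian), Finset.mul_sum]
    refine Finset.sum_congr rfl fun b _ => ?_
    simp only [Equiv.arrowProdEquivProdArrow, Equiv.coe_fn_symm_mk, Finset.prod_mul_distrib,
      blockProb, e]
    ring

theorem atypicalError_nonneg (n : ℕ) : 0 ≤ E.atypicalError δ n :=
  Finset.sum_nonneg fun x _ => mul_nonneg (E.blockProb_nonneg x)
    (re_trace_mul_nonneg (E.blockState_nonneg x) (sub_nonneg.mpr (E.Λ_le_one δ x)))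

theorem atypicalError_le (n : ℕ) :
    E.atypicalError δ n ≤ atypicalMass E.p E.p E.H δ n +
      (3 * (((tensor fun _ : Fin n => E.avg) * (1 - E.typProj δ n)).trace).re +
      2 * ∑ x : Fin n → A, E.blockProb x *
        ((E.blockState x * (1 - E.condTypProj δ x)).trace).re) := by
  rw [← E.sum_blockProb_mul_re_trace, atypicalMass, Finset.mul_sum, Finset.mul_sum,
    ← Finset.sum_add_distrib, ← Finset.sum_add_distrib, atypicalError]
  refine Finset.sum_le_sum fun x _ => ?_
  have h := re_trace_mul_le_re_trace_mul (E.blockState_nonneg x) (E.one_sub_Λ_le δ x)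
  rw [mul_add, mul_add, mul_smul_comm, mul_smul_comm, mul_smul_comm, mul_one,
    Matrix.trace_add, Matrix.trace_add, Matrix.trace_smul, Matrix.trace_smul, Matrix.trace_smul,
    E.trace_blockState, Complex.add_re, Complex.add_re] at h
  refine (mul_le_mul_of_nonneg_left h (E.blockProb_nonneg x)).trans (le_of_eq ?_)
  simp [blockProb]
  ring

theorem tendsto_atypicalError (hδ : 0 < δ) :
    Filter.Tendsto (E.atypicalError δ) Filter.atTop (nhds 0) := by
  have h := (tendsto_atypicalMass E.p_nonneg E.p_sum (g := E.p) (h := E.H)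
    (fun a ha => (E.p_nonneg a).lt_of_ne' ha) rfl hδ).add
    (((tendsto_re_trace_tensor_avg E hδ).const_mul 3).add
      ((tendsto_sum_re_trace_condTypProj E hδ).const_mul 2))
  simp only [mul_zero, add_zero] at h
  exact squeeze_zero (atypicalError_nonneg E) (atypicalError_le E) h

theorem tendsto_avgError (hδ : 0 < δ) {Y K : ℕ → Type*} [∀ n, Fintype (Y n)]
    [∀ n, DecidableEq (Y n)] [∀ n, Fintype (K n)]
    (F : ∀ n, RandomHash (Fin n → A) (Y n) (K n)) (hF : ∀ n, (F n).IsTwoUniversal)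
    (hY : ∀ n : ℕ, (n : ℝ) * (E.H - E.χ + 4 * δ) ≤ Real.logb 2 (Fintype.card (Y n) : ℝ)) :
    Filter.Tendsto (fun n => avgError E δ (F n)) Filter.atTop (nhds 0) := by
  have hgeom : Filter.Tendsto (fun n : ℕ => ((2 : ℝ) ^ (-δ)) ^ n) Filter.atTop (nhds 0) :=
    tendsto_pow_atTop_nhds_zero_of_lt_one (by positivity)
      (Real.rpow_lt_one_of_one_lt_of_neg one_lt_two (by linarith))
  have hlim := ((tendsto_atypicalError E hδ).const_mul 2).add (hgeom.const_mul 4)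
  simp only [mul_zero, add_zero] at hlim
  refine squeeze_zero (fun n => avgError_nonneg E δ (F n)) (fun n => ?_) hlim
  refine (avgError_le E δ (hF n)).trans (add_le_add le_rfl ?_)
  -- The weights `q` and `p` sum to 1, so a seed and a letter exist, and evaluating the hash gives a
  -- point of `Y n`.
  have hcard : 0 < (Fintype.card (Y n) : ℝ) := by
    obtain ⟨k⟩ : Nonempty (K n) := by
      by_contra hK
      have := not_nonempty_iff.mp hK
      simpa using (F n).q_sum
    obtain ⟨a⟩ : Nonempty A := by
      by_contra hA
      have := not_nonempty_iff.mp hA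
      simpa using E.p_sum
    exact Nat.cast_pos.mpr (Fintype.card_pos_iff.mpr ⟨(F n).f k fun _ => a⟩)
  have hn := (Real.le_logb_iff_rpow_le one_lt_two hcard).mp (hY n)
  rw [mul_div_assoc]
  gcongr
  rw [div_le_iff₀ hcard]
  -- The spare `δ` in the exponent supplies the decaying factor `2^{-nδ}`.
  refine le_trans (le_of_eq ?_) (mul_le_mul_of_nonneg_left hn (by positivity))
  rw [← Real.rpow_mul_natCast zero_le_two, ← Real.rpow_add two_pos]
  congr 1
  ring

end Asymptotics

end HolevoHash

theorem mainTheorem4 {A B : Type*} [Fintype A] [Fintype B] [DecidableEq B]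
    (E : HolevoHash.Ensemble A B) (δ : ℝ) (hδ : 0 < δ) :
    -- for every hash function and every announced value, Bob's operators form a (sub-)POVM
    (∀ (n : ℕ) (Y : Type*) [DecidableEq Y] (f : (Fin n → A) → Y),
      (∀ y, (E.povm δ f y).PosSemidef) ∧
        ∀ h : Y, (1 - ∑ y with f y = h, E.povm δ f y).PosSemidef) ∧
    -- the bound on the average error probability
    (∀ ε : ℝ, 0 < ε → ∃ N : ℕ, ∀ n : ℕ, N ≤ n →
      ∀ (Y K : Type*) [Fintype Y] [DecidableEq Y] [Fintype K]
        (F : HolevoHash.RandomHash (Fin n → A) Y K), F.IsTwoUniversal →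
        HolevoHash.avgError E δ F ≤
          8 * ε + 4 * (2 : ℝ) ^ ((n : ℝ) * (E.H - E.χ + 3 * δ)) / (Fintype.card Y : ℝ)) ∧
    -- vanishing error when the hash has `n [H(p) - χ + 4 δ]` bits
    (∀ (Y K : ℕ → Type*) [∀ n, Fintype (Y n)] [∀ n, DecidableEq (Y n)] [∀ n, Fintype (K n)]
      (F : ∀ n, HolevoHash.RandomHash (Fin n → A) (Y n) (K n)),
      (∀ n, (F n).IsTwoUniversal) →
      (∀ n : ℕ, (n : ℝ) * (E.H - E.χ + 4 * δ) ≤ Real.logb 2 (Fintype.card (Y n) : ℝ)) →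
      Filter.Tendsto (fun n => HolevoHash.avgError E δ (F n)) Filter.atTop (nhds 0)) := by
  open scoped MatrixOrder in
  refine ⟨fun n Y _ f => ⟨fun y => Matrix.nonneg_iff_posSemidef.mp (E.povm_nonneg δ f y),
    fun h => Matrix.le_iff.mp (E.sum_povm_le_one δ f h)⟩, fun ε hε => ?_,
    fun Y K _ _ _ F hF hY => HolevoHash.tendsto_avgError E hδ F hF hY⟩
  -- `atypicalError` does not involve the hash, so `N` is uniform in it; the factor 2 in
  -- `avgError_le` turns `4ε` into `8ε`.
  obtain ⟨N, hN⟩ := Filter.eventually_atTop.mp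
    ((HolevoHash.tendsto_atypicalError E hδ).eventually_le_const (by positivity : 0 < 4 * ε))
  refine ⟨N, fun n hn Y K _ _ _ F hF => (HolevoHash.avgError_le E δ hF).trans ?_⟩
  linarith [hN n hn]
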